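/- Let $\Bbbk$ be an algebraically closed field, $H$ a Hopf algebra over $\Bbbk$ that is finitely generated as an algebra, and $C \subseteq H$ a central Hopf subalgebra such that $H$ is a finitely generated $C$-module. Let $\mathfrak{m}_{\overline{\varepsilon}} \subset C$ be the kernel of the restriction to $C$ of the counit of $H$, and assume that the finite dimensional algebra $H/\mathfrak{m}_{\overline{\varepsilon}}H$ is basic, i.e., that its quotient by its Jacobson radical is isomorphic to a finite product of copies of $\Bbbk$. For a $\Bbbk$-algebra $A$ let $\mathrm{Irr}(A)$ be the set of isomorphism classes of irreducible left $A$-modules. Let $G_0$ be the group, under convolution, of all characters (algebra homomorphisms to $\Bbbk$) of the Hopf algebra $H/\mathfrak{m}_{\overline{\varepsilon}}H$. For a maximal ideal $\mathfrak{m}$ of $C$ and $V \in \mathrm{Irr}(H/\mathfrak{m}H)$, let $$\mathrm{Stab}_{G_0}(V) := \{\chi \in G_0 \mid \chi \otimes V \cong V \text{ as } H\text{-modules}\},$$ where $H$ acts on the tensor product through its coproduct and $\chi$ also denotes the one-dimensional $H$-module it defines. Call $V$ maximally stable if $|\mathrm{Stab}_{G_0}(V)| = \dim_\Bbbk(V)^2$.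 The square dimension function of $(H,C)$ is $$\mathrm{Sd} : \mathrm{MaxSpec}\, C \to \mathbb{Z}, \qquad \mathrm{Sd}(\mathfrak{m}) := \sum_{V \in \mathrm{Irr}(H/\mathfrak{m}H)} \dim_\Bbbk(V)^2 .$$ Then $G_0$ is finite and, for every $\mathfrak{m} \in \mathrm{MaxSpec}\, C$, the set $\mathrm{Irr}(H/\mathfrak{m}H)$ is finite and nonempty and consists of finite dimensional modules (so that all quantities below are well defined), and the following hold. (a) For all $\mathfrak{m} \in \mathrm{MaxSpec}\, C$ and all $V \in \mathrm{Irr}(H/\mathfrak{m}H)$, $$\mathrm{Sd}(\mathfrak{m}) = \frac{|G_0| \dim_\Bbbk(V)^2}{|\mathrm{Stab}_{G_0}(V)|}.$$ (b) The minimum value of $\mathrm{Sd}$ on $\mathrm{MaxSpec}\, C$ is $|G_0|$ (and it is attained). (c) For $\mathfrak{m} \in \mathrm{MaxSpec}\, C$ the following are equivalent: (i) $\mathrm{Sd}(\mathfrak{m}) = |G_0|$, i.e., $\mathfrak{m}$ belongs to the lowest level set of $\mathrm{Sd}$; (ii) there exists $V \in \mathrm{Irr}(H/\mathfrak{m}H)$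 that is maximally stable; (iii) all $V \in \mathrm{Irr}(H/\mathfrak{m}H)$ are maximally stable. -/

import Mathlib

open scoped TensorProduct

universe u v

/-- A central Hopf subalgebra `C` of a Hopf algebra `H` over `𝕜`: a unital subalgebra consisting of
central elements, with `Δ(C) ⊆ C ⊗ C` and `S(C) ⊆ C`. -/
structure CentralHopfSubalgebra (𝕜 : Type v) (H : Type u) [Field 𝕜] [Ring H] [HopfAlgebra 𝕜 H]
    extends Subalgebra 𝕜 H where
  central' : ∀ c ∈ carrier, ∀ h : H, c * h = h * c
  comul_mem' : ∀ c ∈ carrier, Coalgebra.comul (R := 𝕜) c ∈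
    LinearMap.range (TensorProduct.map toSubalgebra.val.toLinearMap toSubalgebra.val.toLinearMap)
  antipode_mem' : ∀ c ∈ carrier, HopfAlgebra.antipode 𝕜 c ∈ carrier

namespace CentralHopfSubalgebra

variable {𝕜 : Type v} {H : Type u} [Field 𝕜] [Ring H] [HopfAlgebra 𝕜 H]

instance instCommRing (C : CentralHopfSubalgebra 𝕜 H) : CommRing C.toSubalgebra :=
  { (inferInstance : Ring C.toSubalgebra) with
    mul_comm := fun a b => Subtype.ext (C.central' a.1 a.2 b.1) }

/-- The two-sided ideal `𝔪H` of `H` generated by an ideal `𝔪` of `C`. As `C` is central, the left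
ideal generated by `𝔪` is two-sided. -/
def fiberIdeal (C : CentralHopfSubalgebra 𝕜 H) (m : Ideal C.toSubalgebra) : Ideal H :=
  Ideal.span (Subtype.val '' (m : Set C.toSubalgebra))

instance fiberIdeal_isTwoSided (C : CentralHopfSubalgebra 𝕜 H) (m : Ideal C.toSubalgebra) :
    (C.fiberIdeal m).IsTwoSided where
  mul_mem_of_left {a} b ha := by
    unfold fiberIdeal at ha ⊢
    induction ha using Submodule.span_induction with
    | mem x hx =>
      obtain ⟨c, hc, rfl⟩ := hx
      rw [C.central' c.1 c.2 b]
      exact Ideal.mul_mem_left _ _ (Ideal.subset_span ⟨c, hc, rfl⟩)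
    | zero => simp
    | add x y _ _ hx hy => rw [add_mul]; exact Ideal.add_mem _ hx hy
    | smul r x _ hx => rw [smul_eq_mul, mul_assoc]; exact Ideal.mul_mem_left _ _ hx

/-- The fiber algebra `H / 𝔪H`. -/
abbrev Fiber (C : CentralHopfSubalgebra 𝕜 H) (m : Ideal C.toSubalgebra) : Type u :=
  H ⧸ C.fiberIdeal m

/-- The restriction `ε̄ : C → 𝕜` of the counit of `H`. -/
noncomputable def counitRestrict (C : CentralHopfSubalgebra 𝕜 H) : C.toSubalgebra →ₐ[𝕜] 𝕜 :=
  (Bialgebra.counitAlgHom 𝕜 H).comp C.toSubalgebra.val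

/-- The augmentation ideal `𝔪_ε̄ = ker ε̄`, a maximal ideal of `C`. -/
noncomputable def augmentation (C : CentralHopfSubalgebra 𝕜 H) :
    MaximalSpectrum C.toSubalgebra where
  asIdeal := RingHom.ker C.counitRestrict
  isMaximal := RingHom.ker_isMaximal_of_surjective _ fun x =>
    ⟨algebraMap 𝕜 C.toSubalgebra x, C.counitRestrict.commutes x⟩

/-- The identity fiber `H / 𝔪_ε̄ H`. -/
abbrev IdentityFiber (C : CentralHopfSubalgebra 𝕜 H) : Type u :=
  C.Fiber C.augmentation.asIdeal

/-- `G₀`: the group-like elements of the restricted dual of the identity fiber, that is, the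
characters (algebra homomorphisms to `𝕜`) of `H / 𝔪_ε̄ H`. -/
abbrev G₀ (C : CentralHopfSubalgebra 𝕜 H) : Type (max u v) :=
  C.IdentityFiber →ₐ[𝕜] 𝕜

end CentralHopfSubalgebra

/-- A finite dimensional algebra over an algebraically closed field `𝕜` is basic if its quotient by
the Jacobson radical is isomorphic to a finite product of copies of `𝕜`. -/
def IsBasicAlgebra (𝕜 : Type v) (A : Type u) [Field 𝕜] [Ring A] [Algebra 𝕜 A] : Prop :=
  ∃ n : ℕ, Nonempty ((A ⧸ Ring.jacobson A) ≃ₐ[𝕜] (Fin n → 𝕜))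

/-- An irreducible (left) module over the `𝕜`-algebra `A`. Every irreducible `A`-module is
isomorphic to a quotient of `A`, so the universe of `A` suffices for the carrier. -/
structure IrrModule (𝕜 : Type v) (A : Type u) [Field 𝕜] [Ring A] [Algebra 𝕜 A] where
  carrier : Type u
  [addCommGroup : AddCommGroup carrier]
  [module : Module 𝕜 carrier]
  [moduleAlg : Module A carrier]
  [isScalarTower : IsScalarTower 𝕜 A carrier]
  [isSimple : IsSimpleModule A carrier]

namespace IrrModule

attribute [instance] addCommGroup module moduleAlg isScalarTower isSimple

variable {𝕜 : Type v} {A : Type u} [Field 𝕜] [Ring A] [Algebra 𝕜 A]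

/-- The dimension over `𝕜`. -/
noncomputable def dim (V : IrrModule 𝕜 A) : ℕ := Module.finrank 𝕜 V.carrier

/-- The relation of being isomorphic as `A`-modules. -/
instance setoid : Setoid (IrrModule 𝕜 A) where
  r V W := Nonempty (V.carrier ≃ₗ[A] W.carrier)
  iseqv :=
    { refl := fun V => ⟨LinearEquiv.refl A V.carrier⟩
      symm := fun ⟨e⟩ => ⟨e.symm⟩
      trans := fun ⟨e⟩ ⟨f⟩ => ⟨e.trans f⟩ }

theorem dim_eq_of_equiv (V W : IrrModule 𝕜 A) (h : V ≈ W) : V.dim = W.dim := by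
  obtain ⟨e⟩ := h
  exact LinearEquiv.finrank_eq (e.restrictScalars 𝕜)

end IrrModule

/-- `Irr(A)`: the isomorphism classes of irreducible `A`-modules. -/
def Irr (𝕜 : Type v) (A : Type u) [Field 𝕜] [Ring A] [Algebra 𝕜 A] : Type (max (u + 1) v) :=
  Quotient (IrrModule.setoid (𝕜 := 𝕜) (A := A))

/-- The dimension of an isomorphism class of irreducible modules. -/
noncomputable def Irr.dim {𝕜 : Type v} {A : Type u} [Field 𝕜] [Ring A] [Algebra 𝕜 A] :
    Irr 𝕜 A → ℕ :=
  Quotient.lift IrrModule.dim IrrModule.dim_eq_of_equiv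

section Representations

variable {𝕜 : Type v} {H : Type u} [Field 𝕜] [Ring H] [HopfAlgebra 𝕜 H]

/-- The tensor product of two `H`-modules (given by their structure maps), with `H` acting through
the coproduct: `h • (x ⊗ y) = ∑ h₍₁₎ x ⊗ h₍₂₎ y`. -/
noncomputable def tensorRep {V W : Type*} [AddCommGroup V] [Module 𝕜 V] [AddCommGroup W]
    [Module 𝕜 W] (ρ : H →ₐ[𝕜] Module.End 𝕜 V) (σ : H →ₐ[𝕜] Module.End 𝕜 W) :
    H →ₐ[𝕜] Module.End 𝕜 (V ⊗[𝕜] W) :=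
  (Module.endTensorEndAlgHom (R := 𝕜) (S := 𝕜) (A := 𝕜)).comp
    ((Algebra.TensorProduct.map ρ σ).comp (Bialgebra.comulAlgHom 𝕜 H))

/-- The one-dimensional `H`-module given by a character `χ` of `H`. -/
noncomputable def charRep (χ : H →ₐ[𝕜] 𝕜) : H →ₐ[𝕜] Module.End 𝕜 𝕜 :=
  (Algebra.lmul 𝕜 𝕜).comp χ

/-- Two `H`-modules, given by their structure maps, are isomorphic. -/
def RepIso {V W : Type*} [AddCommGroup V] [Module 𝕜 V] [AddCommGroup W] [Module 𝕜 W]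
    (ρ : H →ₐ[𝕜] Module.End 𝕜 V) (σ : H →ₐ[𝕜] Module.End 𝕜 W) : Prop :=
  ∃ e : V ≃ₗ[𝕜] W, ∀ (h : H) (x : V), e (ρ h x) = σ h (e x)

end Representations

namespace CentralHopfSubalgebra

variable {𝕜 : Type v} {H : Type u} [Field 𝕜] [Ring H] [HopfAlgebra 𝕜 H]

/-- The element of `G₀` viewed as a character of `H` by composing with `H → H / 𝔪_ε̄ H`. -/
noncomputable def G₀.toChar {C : CentralHopfSubalgebra 𝕜 H} (χ : C.G₀) : H →ₐ[𝕜] 𝕜 :=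
  χ.comp (Ideal.Quotient.mkₐ 𝕜 (C.fiberIdeal C.augmentation.asIdeal))

/-- The action of `H` on an irreducible module of the fiber `H / 𝔪H`. -/
noncomputable def fiberRep (C : CentralHopfSubalgebra 𝕜 H) {m : Ideal C.toSubalgebra}
    (V : IrrModule 𝕜 (C.Fiber m)) : H →ₐ[𝕜] Module.End 𝕜 V.carrier :=
  (Algebra.lsmul 𝕜 𝕜 V.carrier).comp (Ideal.Quotient.mkₐ 𝕜 (C.fiberIdeal m))

/-- The stabilizer `Stab_{G₀}(V) = {χ ∈ G₀ | χ ⊗ V ≅ V}`. -/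
def stab (C : CentralHopfSubalgebra 𝕜 H) {m : Ideal C.toSubalgebra}
    (V : IrrModule 𝕜 (C.Fiber m)) : Set C.G₀ :=
  {χ | RepIso (tensorRep (charRep (G₀.toChar χ)) (C.fiberRep V)) (C.fiberRep V)}

/-- `V` is maximally stable if `|Stab_{G₀}(V)| = dim(V)²`. -/
def IsMaximallyStable (C : CentralHopfSubalgebra 𝕜 H) {m : Ideal C.toSubalgebra}
    (V : IrrModule 𝕜 (C.Fiber m)) : Prop :=
  Nat.card (C.stab V) = V.dim ^ 2

/-- The square dimension function `Sd(𝔪) = ∑_{V ∈ Irr(H/𝔪H)} dim(V)²`. -/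
noncomputable def sqDim (C : CentralHopfSubalgebra 𝕜 H) (m : MaximalSpectrum C.toSubalgebra) : ℕ :=
  ∑ᶠ V : Irr 𝕜 (C.Fiber m.asIdeal), V.dim ^ 2

end CentralHopfSubalgebra

/-!
All irreducible modules over a fiber `H / 𝔪H` are related by tensoring with characters in `G₀`, and
the formulas for `Sd` are orbit counting for this action.

Tensoring `V` with a character `χ` is the same as restricting the action on `V` along the winding
homomorphism `h ↦ ∑ χ(h₍₁₎) h₍₂₎` (`lid_tensorRep_charRep`). If `χ` restricts to the counit on `C`,
its winding homomorphism fixes `C`, so that the group `G₀` acts on `Irr(H / 𝔪H)` for every `𝔪`.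

For an algebra homomorphism `ρ : H → E`, let `H` act on `E` by
`h • F = ∑ ρ(h₍₁₎) F ρ(S(h₍₂₎))`. An eigenvector `F` with eigencharacter `χ` is the
same as an element with `ρ(h) F = F ρ(∑ χ(h₍₁₎) h₍₂₎)` (`adjointAction_eq_smul_iff`). If `ρ(C)`
consists of scalars, then `C` acts on `E` through the counit, so `E` is a module over the identity
fiber (`exists_adjointAction_lift`). Two consequences follow.

* Transitivity (`exists_charTwist_equiv`): for irreducible `V` and `W` over the same fiber take
  `E = End(V × W)`, where `C` acts by scalars by the Nullstellensatz and the Artin–Tate lemma. As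
  the identity fiber is basic, its module `Hom(W, V)` contains an eigenvector, which is a nonzero
  intertwining map from a twist of `W` to `V`, hence an isomorphism.
* The bound `|Stab(V)| ≤ dim(V)²` (`card_stab_le`): for `E = End(V)`, isomorphisms `χ ⊗ V ≅ V` for
  distinct `χ` are eigenvectors with distinct eigencharacters, hence linearly independent.

By transitivity `Sd(𝔪) = |G₀| dim(V)² / |Stab(V)|`, which with the bound gives `Sd(𝔪) ≥ |G₀|`, with
equality exactly when `V` is maximally stable. Over the identity fiber the irreducible modules are
one-dimensional and equality holds.
-/

/-! ### Characters of a Hopf algebra and their winding homomorphisms -/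

section Winding

open WithConv Coalgebra

variable {𝕜 : Type*} {H : Type*} [Field 𝕜] [Ring H] [HopfAlgebra 𝕜 H]

/-- The convolution inverse of a character is its composite with the antipode. -/
noncomputable instance charInv : Inv (WithConv (H →ₐ[𝕜] 𝕜)) where
  inv χ := toConv (AlgHom.ofLinearMap (χ.ofConv.toLinearMap ∘ₗ HopfAlgebra.antipode 𝕜)
    (by simp) (fun a b => by
      simp [HopfAlgebra.antipode_mul_antidistrib, mul_comm]))

/-- The characters of a Hopf algebra, commutative or not, form a group under convolution. -/
noncomputable instance charGroup : Group (WithConv (H →ₐ[𝕜] 𝕜)) where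
  inv_mul_cancel χ := by
    apply ofConv_injective
    apply AlgHom.toLinearMap_injective
    apply toConv_injective
    rw [AlgHom.toLinearMap_convMul, AlgHom.toLinearMap_convOne]
    have h := LinearMap.algHom_comp_convMul_distrib χ.ofConv
      (toConv (HopfAlgebra.antipode 𝕜 (A := H))) (toConv LinearMap.id)
    rw [LinearMap.antipode_mul_id] at h
    refine (congrArg toConv h).symm.trans ?_
    ext x
    simp [LinearMap.convOne_def]

/-- The winding homomorphism `h ↦ ∑ χ(h₍₁₎) h₍₂₎` attached to a character `χ`. Restricting a module
along it amounts to tensoring with `χ` on the left. -/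
noncomputable def winding (χ : WithConv (H →ₐ[𝕜] 𝕜)) : H →ₐ[𝕜] H :=
  (Algebra.TensorProduct.lid 𝕜 H).toAlgHom.comp
    ((Algebra.TensorProduct.map χ.ofConv (AlgHom.id 𝕜 H)).comp (Bialgebra.comulAlgHom 𝕜 H))

theorem winding_apply (χ : WithConv (H →ₐ[𝕜] 𝕜)) (h : H) :
    winding χ h = TensorProduct.lid 𝕜 H
      (TensorProduct.map χ.ofConv.toLinearMap LinearMap.id (comul (R := 𝕜) h)) := rfl

/-- A character with values in an algebra `E`, as an element of the convolution algebra. -/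
noncomputable def scalarConv (E : Type*) [Ring E] [Algebra 𝕜 E] (χ : WithConv (H →ₐ[𝕜] 𝕜)) :
    WithConv (H →ₗ[𝕜] E) :=
  toConv (Algebra.linearMap 𝕜 E ∘ₗ χ.ofConv.toLinearMap)

theorem scalarConv_mul (E : Type*) [Ring E] [Algebra 𝕜 E] (χ ψ : WithConv (H →ₐ[𝕜] 𝕜)) :
    scalarConv E (χ * ψ) = scalarConv E χ * scalarConv E ψ :=
  congrArg toConv (LinearMap.algHom_comp_convMul_distrib (Algebra.ofId 𝕜 E)
    (toConv χ.ofConv.toLinearMap) (toConv ψ.ofConv.toLinearMap))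

theorem toConv_comp_winding {E : Type*} [Ring E] [Algebra 𝕜 E] (ρ : H →ₐ[𝕜] E)
    (χ : WithConv (H →ₐ[𝕜] 𝕜)) :
    toConv (ρ.comp (winding χ)).toLinearMap = scalarConv E χ * toConv ρ.toLinearMap := by
  ext h
  have : ∀ t : H ⊗[𝕜] H, ρ (TensorProduct.lid 𝕜 H
      (TensorProduct.map χ.ofConv.toLinearMap LinearMap.id t)) =
      LinearMap.mul' 𝕜 E (TensorProduct.map (Algebra.linearMap 𝕜 E ∘ₗ χ.ofConv.toLinearMap)
        ρ.toLinearMap t) := by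
    intro t
    induction t with
    | zero => simp
    | add x y hx hy => simp only [map_add, hx, hy]
    | tmul a b => simp [Algebra.smul_def]
  exact this _

theorem winding_comp_winding (χ ψ : WithConv (H →ₐ[𝕜] 𝕜)) :
    (winding χ).comp (winding ψ) = winding (ψ * χ) := by
  apply AlgHom.toLinearMap_injective
  apply toConv_injective
  have h (φ : WithConv (H →ₐ[𝕜] 𝕜)) : toConv (winding φ).toLinearMap =
      scalarConv H φ * toConv LinearMap.id := toConv_comp_winding (AlgHom.id 𝕜 H) φ
  rw [toConv_comp_winding, h, h, scalarConv_mul, mul_assoc]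

theorem winding_one : winding (1 : WithConv (H →ₐ[𝕜] 𝕜)) = AlgHom.id 𝕜 H := by
  ext h
  have := congrArg (TensorProduct.lid 𝕜 H) (rTensor_counit_comul (R := 𝕜) h)
  rw [TensorProduct.lid_tmul, one_smul] at this
  exact this

theorem winding_winding_inv (χ : WithConv (H →ₐ[𝕜] 𝕜)) (h : H) :
    winding χ (winding χ⁻¹ h) = h := by
  have := winding_comp_winding χ χ⁻¹
  rw [inv_mul_cancel, winding_one] at this
  exact DFunLike.congr_fun this h

end Winding

/-! ### The adjoint action -/

section Adjoint

open WithConv Coalgebra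

variable {𝕜 : Type*} {H : Type*} [Field 𝕜] [Ring H] [HopfAlgebra 𝕜 H]
  {E : Type*} [Ring E] [Algebra 𝕜 E]

/-- The adjoint action `h • F = ∑ ρ(h₍₁₎) F ρ(S(h₍₂₎))` of `H` on an algebra `E`, for an algebra
homomorphism `ρ : H → E`. -/
noncomputable def adjointAction (ρ : H →ₐ[𝕜] E) : H →ₐ[𝕜] Module.End 𝕜 E :=
  (AlgHom.mulLeftRight 𝕜 E).comp
    ((Algebra.TensorProduct.map ρ
      ((AlgHom.op ρ).comp (HopfAlgebra.antipodeAlgHomOp 𝕜 H))).comp (Bialgebra.comulAlgHom 𝕜 H))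

theorem adjointAction_apply (ρ : H →ₐ[𝕜] E) (h : H) (F : E) :
    adjointAction ρ h F = LinearMap.mul' 𝕜 E
      (TensorProduct.map (LinearMap.mulRight 𝕜 F ∘ₗ ρ.toLinearMap)
        (ρ.toLinearMap ∘ₗ HopfAlgebra.antipode 𝕜) (comul (R := 𝕜) h)) := by
  change AlgHom.mulLeftRight 𝕜 E (Algebra.TensorProduct.map ρ
      ((AlgHom.op ρ).comp (HopfAlgebra.antipodeAlgHomOp 𝕜 H)) (comul (R := 𝕜) h)) F = _
  generalize comul (R := 𝕜) h = t
  induction t with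
  | zero => simp
  | add x y hx hy => simp only [map_add, LinearMap.add_apply, hx, hy]
  | tmul a b => simp [AlgHom.mulLeftRight_apply]

/-- An element `F` is an eigenvector of the adjoint action with eigencharacter `χ` exactly when
multiplication by `F` intertwines `ρ` with its twist by the winding homomorphism of `χ`. In the
convolution algebra, `ρF * ρS = χF` and `ρF = χF * ρ` are equivalent because `ρS` is the inverse
of `ρ`. -/
theorem adjointAction_eq_smul_iff (ρ : H →ₐ[𝕜] E) (χ : WithConv (H →ₐ[𝕜] 𝕜)) (F : E) :
    (∀ h, adjointAction ρ h F = χ.ofConv h • F) ↔ ∀ h, ρ h * F = F * ρ (winding χ h) := by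
  let L : WithConv (H →ₗ[𝕜] E) := toConv (LinearMap.mulRight 𝕜 F ∘ₗ ρ.toLinearMap)
  let X : WithConv (H →ₗ[𝕜] E) := toConv (LinearMap.toSpanSingleton 𝕜 E F ∘ₗ χ.ofConv.toLinearMap)
  let r : WithConv (H →ₗ[𝕜] E) := toConv ρ.toLinearMap
  let s : WithConv (H →ₗ[𝕜] E) := toConv (ρ.toLinearMap ∘ₗ HopfAlgebra.antipode 𝕜)
  have hrs : r * s = 1 := by
    have h := LinearMap.algHom_comp_convMul_distrib ρ
      (toConv LinearMap.id) (toConv (HopfAlgebra.antipode 𝕜 (A := H)))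
    rw [LinearMap.id_mul_antipode] at h
    refine (congrArg toConv h).symm.trans ?_
    ext x
    simp [LinearMap.convOne_def]
  have hsr : s * r = 1 := by
    have h := LinearMap.algHom_comp_convMul_distrib ρ
      (toConv (HopfAlgebra.antipode 𝕜 (A := H))) (toConv LinearMap.id)
    rw [LinearMap.antipode_mul_id] at h
    refine (congrArg toConv h).symm.trans ?_
    ext x
    simp [LinearMap.convOne_def]
  have hX : X * r = toConv (LinearMap.mulLeft 𝕜 F ∘ₗ (ρ.comp (winding χ)).toLinearMap) := by
    have key := toConv_comp_winding ρ χ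
    ext h
    have key' : ρ (winding χ h) = (scalarConv E χ * toConv ρ.toLinearMap) h :=
      congrArg (fun φ : WithConv (H →ₗ[𝕜] E) => φ h) key
    change _ = F * ρ (winding χ h)
    rw [key', (ℛ 𝕜 h).convMul_apply, (ℛ 𝕜 h).convMul_apply, Finset.mul_sum]
    refine Finset.sum_congr rfl fun i _ => ?_
    simp [X, r, scalarConv, Algebra.algebraMap_eq_smul_one]
  have h1 : (∀ h, adjointAction ρ h F = χ.ofConv h • F) ↔ L * s = X := by
    constructor
    · intro H'
      ext h
      exact (adjointAction_apply ρ h F).symm.trans (H' h)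
    · intro H' h
      exact (adjointAction_apply ρ h F).trans (congrArg (fun φ : WithConv (H →ₗ[𝕜] E) => φ h) H')
  have h2 : (∀ h, ρ h * F = F * ρ (winding χ h)) ↔ L = X * r := by
    rw [hX]
    constructor
    · intro H'
      ext h
      exact H' h
    · intro H' h
      exact congrArg (fun φ : WithConv (H →ₗ[𝕜] E) => φ h) H'
  rw [h1, h2]
  constructor
  · intro h
    rw [← h, mul_assoc, hsr, mul_one]
  · intro h
    rw [h, mul_assoc, hrs, mul_one]

/-- The adjoint action commutes with multiplication by elements centralizing the image of `ρ`. -/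
theorem mul_adjointAction_mul (ρ : H →ₐ[𝕜] E) {e e' : E} (he : ∀ h, Commute e (ρ h))
    (he' : ∀ h, Commute e' (ρ h)) (h : H) (F : E) :
    e * adjointAction ρ h F * e' = adjointAction ρ h (e * F * e') := by
  rw [adjointAction_apply, adjointAction_apply]
  generalize comul (R := 𝕜) h = t
  induction t with
  | zero => simp
  | add x y hx hy => simp only [map_add, mul_add, add_mul, hx, hy]
  | tmul a b =>
    simp only [TensorProduct.map_tmul, LinearMap.comp_apply, LinearMap.mulRight_apply,
      LinearMap.mul'_apply, AlgHom.toLinearMap_apply]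
    calc e * (ρ a * F * ρ (HopfAlgebra.antipode 𝕜 b)) * e'
        = (e * ρ a) * F * (ρ (HopfAlgebra.antipode 𝕜 b) * e') := by simp only [mul_assoc]
      _ = (ρ a * e) * F * (e' * ρ (HopfAlgebra.antipode 𝕜 b)) := by
          rw [(he a).eq, (he' _).eq]
      _ = _ := by simp only [mul_assoc]

end Adjoint

/-! ### Basic algebras and common eigenvectors -/

/-- A nonzero subspace that is stable under a finite dimensional action of a basic algebra contains
a common eigenvector: a simple submodule is killed by the radical, and one of the primitive
idempotents of the quotient `𝕜ⁿ` does not kill it. -/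
theorem IsBasicAlgebra.exists_common_eigenvector {𝕜 : Type v} {A : Type u} [Field 𝕜] [Ring A]
    [Algebra 𝕜 A] (hA : IsBasicAlgebra 𝕜 A) {M : Type*} [AddCommGroup M] [Module 𝕜 M]
    [FiniteDimensional 𝕜 M] (φ : A →ₐ[𝕜] Module.End 𝕜 M) (P : Submodule 𝕜 M) (hP : P ≠ ⊥)
    (hstab : ∀ a, ∀ x ∈ P, φ a x ∈ P) :
    ∃ χ : A →ₐ[𝕜] 𝕜, ∃ x ∈ P, x ≠ 0 ∧ ∀ a, φ a x = χ a • x := by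
  obtain ⟨n, ⟨e⟩⟩ := hA
  let : Module A M := Module.compHom M φ.toRingHom
  have smul_eq (a : A) (x : M) : a • x = φ a x := rfl
  have : IsScalarTower 𝕜 A M := ⟨fun r a x => by simp [smul_eq]⟩
  have : IsArtinian A M := isArtinian_of_tower 𝕜 inferInstance
  let Q : Submodule A M := { P with smul_mem' := fun a x hx => hstab a x hx }
  have hQ : Q ≠ ⊥ := fun h => hP (by
    rw [Submodule.eq_bot_iff] at h ⊢
    exact h)
  obtain ⟨N, hN, hNQ⟩ := (IsAtomic.eq_bot_or_exists_atom_le Q).resolve_left hQ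
  have : IsSimpleModule A N := isSimpleModule_iff_isAtom.2 hN
  obtain ⟨x, hxN, hx⟩ := N.ne_bot_iff.1 hN.1
  have hJ : ∀ a ∈ Ring.jacobson A, a • x = 0 := fun a ha =>
    congrArg Subtype.val (Module.mem_annihilator.1
      (IsSemisimpleModule.jacobson_le_annihilator A N ha) ⟨x, hxN⟩)
  have hcongr (a b : A) (h : e (Ideal.Quotient.mk _ a) = e (Ideal.Quotient.mk _ b)) :
      a • x = b • x := by
    rw [← sub_eq_zero, ← sub_smul]
    exact hJ _ (Ideal.Quotient.eq.1 (e.injective h))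
  -- Lifts to `A` of the primitive idempotents of `𝕜ⁿ`.
  choose c hc using fun i : Fin n =>
    Ideal.Quotient.mk_surjective (I := Ring.jacobson A) (e.symm (Pi.single i 1))
  have hec (i : Fin n) : e (Ideal.Quotient.mk _ (c i)) = Pi.single i 1 := by
    rw [hc, AlgEquiv.apply_symm_apply]
  obtain ⟨i, hi⟩ : ∃ i, c i • x ≠ 0 := by
    by_contra! h
    apply hx
    rw [← one_smul A x, hcongr 1 (∑ i, c i), Finset.sum_smul]
    · simp [h]
    · simp only [map_one, map_sum, hec]
      exact (Finset.univ_sum_single (1 : Fin n → 𝕜)).symm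
  refine ⟨(Pi.evalAlgHom 𝕜 (fun _ : Fin n => 𝕜) i).comp
    (e.toAlgHom.comp (Ideal.Quotient.mkₐ 𝕜 (Ring.jacobson A))), c i • x,
    hNQ (N.smul_mem _ hxN), hi, fun a => ?_⟩
  rw [← smul_eq, smul_smul]
  change (a * c i) • x = e (Ideal.Quotient.mk _ a) i • c i • x
  rw [← smul_assoc]
  apply hcongr
  have hs (r : 𝕜) (b : A) : e (Ideal.Quotient.mk (Ring.jacobson A) (r • b)) =
      r • e (Ideal.Quotient.mk _ b) := by
    rw [← map_smul]; rfl
  rw [hs, map_mul, map_mul, hec]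
  ext j
  by_cases hj : j = i
  · subst hj; simp
  · simp [hj]

section Characters

variable {𝕜 : Type*} [Field 𝕜]

/-- Simultaneous eigenvectors with distinct eigencharacters are linearly independent. -/
theorem linearIndependent_of_eigencharacters {A M ι : Type*} [Ring A] [Algebra 𝕜 A]
    [AddCommGroup M] [Module 𝕜 M] (φ : A →ₐ[𝕜] Module.End 𝕜 M) (χ : ι → A →ₐ[𝕜] 𝕜)
    (hχ : Function.Injective χ) (x : ι → M) (hx : ∀ i, x i ≠ 0)
    (h : ∀ i a, φ a (x i) = χ i a • x i) : LinearIndependent 𝕜 x := by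
  have hinj : Function.Injective (fun i => (χ i : A →* 𝕜)) := fun i j h =>
    hχ (AlgHom.ext fun a => DFunLike.congr_fun h a)
  have hind := (linearIndependent_monoidHom A 𝕜).comp _ hinj
  rw [linearIndependent_iff'] at hind ⊢
  intro s g hg i hi
  by_contra hgi
  refine hx i ((Module.forall_dual_apply_eq_zero_iff 𝕜 (x i)).1 fun f => ?_)
  refine (mul_eq_zero.1 (hind s (fun j => g j * f (x j)) ?_ i hi)).resolve_left hgi
  ext a
  have := congrArg (fun y => f (φ a y)) hg
  simp only [map_sum, map_smul, h, map_zero, smul_eq_mul] at this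
  rw [Finset.sum_apply, Pi.zero_apply, ← this]
  refine Finset.sum_congr rfl fun j _ => ?_
  simp only [Function.comp_apply, Pi.smul_apply, smul_eq_mul, AlgHom.coe_toMonoidHom]
  ring

/-- A finite dimensional algebra has finitely many characters. -/
theorem finite_algHom_of_finiteDimensional (A : Type*) [Ring A] [Algebra 𝕜 A]
    [FiniteDimensional 𝕜 A] : Finite (A →ₐ[𝕜] 𝕜) := by
  have hinj : Function.Injective (fun χ : A →ₐ[𝕜] 𝕜 => (χ : A →* 𝕜)) := fun χ ψ h =>
    AlgHom.ext fun a => DFunLike.congr_fun h a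
  have h := (linearIndependent_monoidHom A 𝕜).comp _ hinj
  have h' : LinearIndependent 𝕜 (fun χ : A →ₐ[𝕜] 𝕜 => χ.toLinearMap) :=
    LinearIndependent.of_comp (LinearMap.ltoFun 𝕜 A 𝕜 𝕜) h
  exact h'.finite

end Characters

/-! ### Fibers of a central subalgebra -/

namespace CentralHopfSubalgebra

variable {𝕜 : Type v} {H : Type u} [Field 𝕜] [Ring H] [HopfAlgebra 𝕜 H]

theorem mk_coe_eq_zero (C : CentralHopfSubalgebra 𝕜 H) (m : Ideal C.toSubalgebra)
    {c : C.toSubalgebra} (hc : c ∈ m) : Ideal.Quotient.mk (C.fiberIdeal m) (c : H) = 0 :=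
  Ideal.Quotient.eq_zero_iff_mem.2 (Ideal.subset_span ⟨c, hc, rfl⟩)

/-- The Artin–Tate lemma for the central subalgebra `C` of the noncommutative algebra `H`. -/
theorem finiteType (C : CentralHopfSubalgebra 𝕜 H) [Algebra.FiniteType 𝕜 H]
    [Module.Finite C.toSubalgebra H] : Algebra.FiniteType 𝕜 C.toSubalgebra := by
  -- Centrality of `C` makes `H` a `C`-algebra.
  let : Algebra C.toSubalgebra H :=
    { (inferInstance : Module C.toSubalgebra H) with
      algebraMap := C.toSubalgebra.val.toRingHom
      commutes' := fun c h => C.central' c.1 c.2 h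
      smul_def' := fun _ _ => rfl }
  obtain ⟨B, hB, hBH⟩ := exists_subalgebra_of_fg 𝕜 C.toSubalgebra H
    (Algebra.FiniteType.out) (Module.Finite.fg_top)
  have : IsNoetherianRing B := isNoetherianRing_of_fg hB
  have : Module.Finite B H := ⟨hBH⟩
  refine ⟨Algebra.fg_trans' (B.fg_top.2 hB) (Subalgebra.fg_of_submodule_fg ?_)⟩
  exact fg_of_injective (IsScalarTower.toAlgHom B C.toSubalgebra H).toLinearMap
    Subtype.val_injective

/-- By the Nullstellensatz, every element of `C` is a scalar modulo a maximal ideal. -/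
theorem exists_sub_algebraMap_mem [IsAlgClosed 𝕜] (C : CentralHopfSubalgebra 𝕜 H)
    [Algebra.FiniteType 𝕜 H] [Module.Finite C.toSubalgebra H]
    (m : MaximalSpectrum C.toSubalgebra) (c : C.toSubalgebra) :
    ∃ r : 𝕜, c - algebraMap 𝕜 C.toSubalgebra r ∈ m.asIdeal := by
  have := C.finiteType
  have := m.isMaximal
  let := Ideal.Quotient.field m.asIdeal
  have := finite_of_finite_type_of_isJacobsonRing 𝕜 (C.toSubalgebra ⧸ m.asIdeal)
  obtain ⟨r, hr⟩ := (IsAlgClosed.algebraMap_bijective_of_isIntegral (k := 𝕜)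
    (K := C.toSubalgebra ⧸ m.asIdeal)).2 (Ideal.Quotient.mk _ c)
  exact ⟨r, Ideal.Quotient.eq.1 hr.symm⟩

/-- `C` acts on each fiber by scalars. -/
theorem exists_mk_coe_eq_algebraMap [IsAlgClosed 𝕜] (C : CentralHopfSubalgebra 𝕜 H)
    [Algebra.FiniteType 𝕜 H] [Module.Finite C.toSubalgebra H]
    (m : MaximalSpectrum C.toSubalgebra) (c : C.toSubalgebra) :
    ∃ r : 𝕜, Ideal.Quotient.mk (C.fiberIdeal m.asIdeal) (c : H) = algebraMap 𝕜 _ r := by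
  obtain ⟨r, hr⟩ := C.exists_sub_algebraMap_mem m c
  refine ⟨r, sub_eq_zero.1 ?_⟩
  rw [← C.mk_coe_eq_zero m.asIdeal hr]
  exact (map_sub _ _ _).symm

theorem finiteDimensional_fiber [IsAlgClosed 𝕜] (C : CentralHopfSubalgebra 𝕜 H)
    [Algebra.FiniteType 𝕜 H] [Module.Finite C.toSubalgebra H]
    (m : MaximalSpectrum C.toSubalgebra) : FiniteDimensional 𝕜 (C.Fiber m.asIdeal) := by
  obtain ⟨s, hs⟩ := Module.Finite.fg_top (R := C.toSubalgebra) (M := H)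
  classical
  refine ⟨⟨s.image (Ideal.Quotient.mk _), ?_⟩⟩
  rw [eq_top_iff]
  rintro x -
  obtain ⟨h, rfl⟩ := Ideal.Quotient.mk_surjective x
  have hh : h ∈ Submodule.span C.toSubalgebra (s : Set H) := hs ▸ Submodule.mem_top
  induction hh using Submodule.span_induction with
  | mem x hx => exact Submodule.subset_span (by simpa using ⟨x, hx, rfl⟩)
  | zero => simp
  | add x y _ _ hx hy => rw [map_add]; exact add_mem hx hy
  | smul c x _ hx =>
    obtain ⟨r, hr⟩ := C.exists_mk_coe_eq_algebraMap m c
    have : Ideal.Quotient.mk (C.fiberIdeal m.asIdeal) (c • x) =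
        r • Ideal.Quotient.mk (C.fiberIdeal m.asIdeal) x := by
      rw [Algebra.smul_def, ← hr, ← map_mul]; rfl
    rw [this]
    exact Submodule.smul_mem _ _ hx

/-- The fibers are nonzero, by Nakayama's lemma and because `C` is contained in `H`. -/
theorem nontrivial_fiber (C : CentralHopfSubalgebra 𝕜 H) [Module.Finite C.toSubalgebra H]
    (m : MaximalSpectrum C.toSubalgebra) : Nontrivial (C.Fiber m.asIdeal) := by
  refine Ideal.Quotient.nontrivial_iff.2 fun htop => ?_
  have hle : (⊤ : Submodule C.toSubalgebra H) ≤ m.asIdeal • ⊤ := by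
    rintro x -
    have hx : x ∈ C.fiberIdeal m.asIdeal := htop ▸ Submodule.mem_top
    unfold fiberIdeal at hx
    induction hx using Submodule.span_induction with
    | mem x hx =>
      obtain ⟨c, hc, rfl⟩ := hx
      have : (c : H) = c • (1 : H) := (mul_one (c : H)).symm
      rw [this]
      exact Submodule.smul_mem_smul hc Submodule.mem_top
    | zero => exact zero_mem _
    | add x y _ _ hx hy => exact add_mem hx hy
    | smul r x _ hx =>
      refine Submodule.smul_induction_on hx (fun c hc h _ => ?_) fun x y hx hy => ?_
      · have : r • (c • h) = c • (r * h) := by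
          change r * ((c : H) * h) = (c : H) * (r * h)
          rw [← mul_assoc, ← C.central' c.1 c.2 r, mul_assoc]
        rw [this]
        exact Submodule.smul_mem_smul hc Submodule.mem_top
      · rw [smul_add]
        exact add_mem hx hy
  obtain ⟨r, hr, hr0⟩ := Submodule.exists_sub_one_mem_and_smul_eq_zero_of_fg_of_le_smul
    m.asIdeal ⊤ Module.Finite.fg_top hle
  have h0 : r = 0 := by
    apply Subtype.ext
    have : (r : H) * 1 = 0 := hr0 1 Submodule.mem_top
    rwa [mul_one] at this
  rw [h0, zero_sub] at hr
  exact m.isMaximal.ne_top ((Ideal.eq_top_iff_one _).2 (by simpa using m.asIdeal.neg_mem hr))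

end CentralHopfSubalgebra

/-! ### Irreducible modules and their twists -/

/-- Simplicity passes along an additive isomorphism that is semilinear over a surjection. -/
theorem isSimpleModule_of_addEquiv {A M N : Type*} [Ring A] [AddCommGroup M] [Module A M]
    [AddCommGroup N] [Module A N] [IsSimpleModule A N] (σ : A →+* A) (hσ : Function.Surjective σ)
    (l : M ≃+ N) (h : ∀ (a : A) x, l (a • x) = σ a • l x) : IsSimpleModule A M := by
  have : RingHomSurjective σ := ⟨hσ⟩
  let l' : M →ₛₗ[σ] N := { l with map_smul' := h }
  exact (l'.isSimpleModule_iff_of_bijective l.bijective).2 inferInstance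

namespace IrrModule

variable {𝕜 : Type v} {A : Type u} [Field 𝕜] [Ring A] [Algebra 𝕜 A]

theorem finiteDimensional [FiniteDimensional 𝕜 A] (V : IrrModule 𝕜 A) :
    FiniteDimensional 𝕜 V.carrier :=
  Module.Finite.trans A V.carrier

instance [Nontrivial A] : Nonempty (IrrModule 𝕜 A) := by
  obtain ⟨I, hI⟩ := Ideal.exists_maximal A
  exact ⟨{ carrier := A ⧸ I
           isSimple := isSimpleModule_iff_isCoatom.2 hI.out }⟩

/-- The structure map of an irreducible module. -/
noncomputable def rep (V : IrrModule 𝕜 A) : A →ₐ[𝕜] Module.End 𝕜 V.carrier :=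
  Algebra.lsmul 𝕜 𝕜 V.carrier

/-- The restriction of an irreducible module along a surjective endomorphism. -/
noncomputable def twist (V : IrrModule 𝕜 A) (σ : A →ₐ[𝕜] A) (hσ : Function.Surjective σ) :
    IrrModule 𝕜 A where
  carrier := V.carrier
  moduleAlg := Module.compHom V.carrier σ.toRingHom
  isScalarTower :=
    let _ := Module.compHom V.carrier σ.toRingHom
    ⟨fun r a x => (congrArg (fun b => V.rep b x) (map_smul σ r a)).trans
      (V.isScalarTower.smul_assoc r (σ a) x)⟩
  isSimple :=
    let M : Module A V.carrier := Module.compHom V.carrier σ.toRingHom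
    @isSimpleModule_of_addEquiv A V.carrier V.carrier _ _ M _ V.moduleAlg V.isSimple σ.toRingHom hσ
      (AddEquiv.refl _) fun _ _ => rfl

/-- Irreducible modules are isomorphic as soon as their structure maps are intertwined by a nonzero
linear map. -/
theorem equiv_of_intertwining (V W : IrrModule 𝕜 A) (f : V.carrier →ₗ[𝕜] W.carrier) (hf : f ≠ 0)
    (h : ∀ (a : A) x, f (a • x) = a • f x) : V ≈ W := by
  let g : V.carrier →ₗ[A] W.carrier := { f with map_smul' := h }
  refine ⟨LinearEquiv.ofBijective g (g.bijective_of_ne_zero fun h0 => hf ?_)⟩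
  ext x
  exact DFunLike.congr_fun h0 x

end IrrModule

namespace IrrModule

variable {𝕜 : Type v} {A : Type u} [Field 𝕜] [Ring A] [Algebra 𝕜 A]

theorem equiv_iff (V W : IrrModule 𝕜 A) : V ≈ W ↔
    ∃ e : V.carrier ≃ₗ[𝕜] W.carrier, ∀ a x, e (V.rep a x) = W.rep a (e x) :=
  ⟨fun ⟨e⟩ => ⟨e.restrictScalars 𝕜, fun a x => e.map_smul a x⟩,
    fun ⟨e, he⟩ => ⟨{ e with map_smul' := he }⟩⟩

/-- The irreducible modules over a basic algebra are one-dimensional. -/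
theorem dim_eq_one_of_isBasicAlgebra [FiniteDimensional 𝕜 A] (hA : IsBasicAlgebra 𝕜 A)
    (V : IrrModule 𝕜 A) : V.dim = 1 := by
  have := V.finiteDimensional
  have := IsSimpleModule.nontrivial A V.carrier
  obtain ⟨χ, x, -, hx, h⟩ := hA.exists_common_eigenvector V.rep ⊤ top_ne_bot (by simp)
  refine finrank_eq_one x hx fun y => ?_
  obtain ⟨a, ha⟩ := IsSimpleModule.toSpanSingleton_surjective A hx y
  exact ⟨χ a, (h a).symm.trans ha⟩

end IrrModule

/-- The isomorphism class of an irreducible module. -/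
def Irr.mk {𝕜 : Type v} {A : Type u} [Field 𝕜] [Ring A] [Algebra 𝕜 A] (V : IrrModule 𝕜 A) :
    Irr 𝕜 A :=
  Quotient.mk _ V

theorem Irr.mk_eq_mk {𝕜 : Type v} {A : Type u} [Field 𝕜] [Ring A] [Algebra 𝕜 A]
    {V W : IrrModule 𝕜 A} : Irr.mk V = Irr.mk W ↔ V ≈ W :=
  Quotient.eq

/-! ### The action of the group of characters on irreducible modules -/

namespace CentralHopfSubalgebra

open WithConv Coalgebra

variable {𝕜 : Type v} {H : Type u} [Field 𝕜] [Ring H] [HopfAlgebra 𝕜 H]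

theorem nonempty_irrModule (C : CentralHopfSubalgebra 𝕜 H) [Module.Finite C.toSubalgebra H]
    (m : MaximalSpectrum C.toSubalgebra) : Nonempty (IrrModule 𝕜 (C.Fiber m.asIdeal)) :=
  have := C.nontrivial_fiber m
  inferInstance

/-- As `Δ(C) ⊆ C ⊗ C`, the value of `f ⊗ g` on `Δ(c)` depends only on `f` and `g` restricted
to `C`. -/
theorem map_comul_congr (C : CentralHopfSubalgebra 𝕜 H) {M N : Type*} [AddCommGroup M] [Module 𝕜 M]
    [AddCommGroup N] [Module 𝕜 N] {f f' : H →ₗ[𝕜] M} {g g' : H →ₗ[𝕜] N}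
    (hf : ∀ c : C.toSubalgebra, f c = f' c) (hg : ∀ c : C.toSubalgebra, g c = g' c)
    (c : C.toSubalgebra) :
    TensorProduct.map f g (comul (R := 𝕜) (c : H)) =
      TensorProduct.map f' g' (comul (R := 𝕜) (c : H)) := by
  obtain ⟨t, ht⟩ := C.comul_mem' c.1 c.2
  rw [← ht]
  clear ht
  induction t with
  | zero => simp
  | add x y hx hy => simp only [map_add, hx, hy]
  | tmul a b => simp [hf, hg]

/-- An algebra homomorphism killing `𝔪` kills the ideal `𝔪H`. -/
theorem eq_zero_of_mem_fiberIdeal (C : CentralHopfSubalgebra 𝕜 H) (m : Ideal C.toSubalgebra)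
    {B : Type*} [Ring B] [Algebra 𝕜 B] (f : H →ₐ[𝕜] B) (hf : ∀ c ∈ m, f (c : H) = 0) (a : H)
    (ha : a ∈ C.fiberIdeal m) : f a = 0 := by
  have : C.fiberIdeal m ≤ RingHom.ker f := by
    unfold fiberIdeal
    rw [Ideal.span_le]
    rintro _ ⟨c, hc, rfl⟩
    exact hf c hc
  exact this ha

/-- The characters of `H` that restrict to the counit on `C`; these are the characters of the
identity fiber, as a group under convolution. -/
noncomputable def charSubgroup (C : CentralHopfSubalgebra 𝕜 H) :
    Subgroup (WithConv (H →ₐ[𝕜] 𝕜)) where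
  carrier := {χ | ∀ c : C.toSubalgebra, χ.ofConv (c : H) = counit (R := 𝕜) (c : H)}
  one_mem' := fun _ => rfl
  mul_mem' := fun {χ ψ} hχ hψ c => by
    refine (congrArg (LinearMap.mul' 𝕜 𝕜)
      (C.map_comul_congr (f := χ.ofConv.toLinearMap) (f' := counit)
        (g := ψ.ofConv.toLinearMap) (g' := counit) hχ hψ c)).trans ?_
    exact congrArg (fun φ : WithConv (H →ₗ[𝕜] 𝕜) => φ (c : H))
      (mul_one (1 : WithConv (H →ₗ[𝕜] 𝕜)))
  inv_mem' := fun {χ} hχ c =>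
    (hχ ⟨_, C.antipode_mem' c.1 c.2⟩).trans (HopfAlgebra.counit_antipode _)

/-- The identification of the group of characters with `G₀`. -/
noncomputable def charEquiv (C : CentralHopfSubalgebra 𝕜 H) : C.charSubgroup ≃ C.G₀ where
  toFun χ := Ideal.Quotient.liftₐ _ χ.1.ofConv
    (C.eq_zero_of_mem_fiberIdeal _ _ fun c hc => (χ.2 c).trans hc)
  invFun χ := ⟨toConv (G₀.toChar χ), fun c => by
    have h : c - algebraMap 𝕜 C.toSubalgebra (counit (R := 𝕜) (c : H)) ∈
        C.augmentation.asIdeal := by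
      change C.counitRestrict _ = 0
      rw [map_sub, AlgHom.commutes]
      exact sub_self _
    have h' : Ideal.Quotient.mk (C.fiberIdeal C.augmentation.asIdeal) (c : H) =
        algebraMap 𝕜 _ (counit (R := 𝕜) (c : H)) :=
      sub_eq_zero.1 ((map_sub (Ideal.Quotient.mk _) _ _).symm.trans (C.mk_coe_eq_zero _ h))
    change χ (Ideal.Quotient.mk _ (c : H)) = _
    rw [h', AlgHom.commutes]
    rfl⟩
  left_inv χ := rfl
  right_inv χ := by
    ext x
    obtain ⟨h, rfl⟩ := Ideal.Quotient.mk_surjective x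
    rfl

theorem toChar_charEquiv (C : CentralHopfSubalgebra 𝕜 H) (χ : C.charSubgroup) :
    G₀.toChar (C.charEquiv χ) = χ.1.ofConv := rfl

/-- Winding homomorphisms of characters in `G₀` fix `C` pointwise. -/
theorem winding_coe (C : CentralHopfSubalgebra 𝕜 H) (χ : C.charSubgroup) (c : C.toSubalgebra) :
    winding χ.1 (c : H) = c := by
  rw [winding_apply, C.map_comul_congr (f := χ.1.ofConv.toLinearMap) (f' := counit)
    (g := LinearMap.id) (g' := LinearMap.id) χ.2 (fun _ => rfl)]
  exact DFunLike.congr_fun winding_one (c : H)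

/-- The endomorphism of the fiber `H / 𝔪H` induced by a winding homomorphism. -/
noncomputable def fiberWinding (C : CentralHopfSubalgebra 𝕜 H) (m : Ideal C.toSubalgebra)
    (χ : C.charSubgroup) : C.Fiber m →ₐ[𝕜] C.Fiber m :=
  Ideal.Quotient.liftₐ _ ((Ideal.Quotient.mkₐ 𝕜 (C.fiberIdeal m)).comp (winding χ.1))
    (C.eq_zero_of_mem_fiberIdeal m _ fun c hc =>
      (congrArg _ (C.winding_coe χ c)).trans (C.mk_coe_eq_zero m hc))

theorem fiberWinding_mk (C : CentralHopfSubalgebra 𝕜 H) (m : Ideal C.toSubalgebra)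
    (χ : C.charSubgroup) (h : H) :
    C.fiberWinding m χ (Ideal.Quotient.mk _ h) = Ideal.Quotient.mk _ (winding χ.1 h) := rfl

theorem fiberWinding_surjective (C : CentralHopfSubalgebra 𝕜 H) (m : Ideal C.toSubalgebra)
    (χ : C.charSubgroup) : Function.Surjective (C.fiberWinding m χ) := by
  intro x
  obtain ⟨h, rfl⟩ := Ideal.Quotient.mk_surjective x
  exact ⟨Ideal.Quotient.mk _ (winding χ.1⁻¹ h), by
    rw [fiberWinding_mk, winding_winding_inv]⟩

/-- The twist of an irreducible module `V` by a character `χ`, a model of `χ ⊗ V` on the space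
of `V`. -/
noncomputable def charTwist (C : CentralHopfSubalgebra 𝕜 H) {m : Ideal C.toSubalgebra}
    (χ : C.charSubgroup) (V : IrrModule 𝕜 (C.Fiber m)) : IrrModule 𝕜 (C.Fiber m) :=
  V.twist (C.fiberWinding m χ) (C.fiberWinding_surjective m χ)

theorem charTwist_equiv_iff (C : CentralHopfSubalgebra 𝕜 H) {m : Ideal C.toSubalgebra}
    (χ : C.charSubgroup) (V W : IrrModule 𝕜 (C.Fiber m)) : C.charTwist χ V ≈ W ↔
    ∃ e : V.carrier ≃ₗ[𝕜] W.carrier,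
      ∀ h x, e (C.fiberRep V (winding χ.1 h) x) = C.fiberRep W h (e x) := by
  refine (IrrModule.equiv_iff _ _).trans
    ⟨fun ⟨e, he⟩ => ⟨e, fun h x => he (Ideal.Quotient.mk _ h) x⟩,
    fun ⟨e, he⟩ => ⟨e, fun a x => ?_⟩⟩
  obtain ⟨h, rfl⟩ := Ideal.Quotient.mk_surjective a
  exact he h x

/-- The group of characters acts on isomorphism classes by twisting. This is a left action because
winding homomorphisms compose in the order opposite to convolution. -/
noncomputable instance irrMulAction (C : CentralHopfSubalgebra 𝕜 H) (m : Ideal C.toSubalgebra) :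
    MulAction C.charSubgroup (Irr 𝕜 (C.Fiber m)) where
  smul χ := Quotient.map (C.charTwist χ) fun V W h => by
    obtain ⟨e, he⟩ := (IrrModule.equiv_iff V W).1 h
    exact (IrrModule.equiv_iff _ _).2 ⟨e, fun a x => he _ x⟩
  one_smul := by
    rintro ⟨V⟩
    refine Quotient.sound ((C.charTwist_equiv_iff _ _ _).2 ⟨LinearEquiv.refl _ _, fun h x => ?_⟩)
    change C.fiberRep V (winding 1 h) x = _
    rw [winding_one]
    rfl
  mul_smul := by
    rintro χ ψ ⟨V⟩
    refine Quotient.sound ((C.charTwist_equiv_iff _ _ _).2 ⟨LinearEquiv.refl _ _, fun h x => ?_⟩)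
    change C.fiberRep V (winding (χ.1 * ψ.1) h) x = _
    rw [← winding_comp_winding]
    rfl

end CentralHopfSubalgebra

/-- Under `𝕜 ⊗ V ≅ V`, the tensor product with a character is the twist by its winding
homomorphism. -/
theorem lid_tensorRep_charRep {𝕜 : Type v} {H : Type u} [Field 𝕜] [Ring H] [HopfAlgebra 𝕜 H]
    {V : Type*} [AddCommGroup V] [Module 𝕜 V] (χ : WithConv (H →ₐ[𝕜] 𝕜))
    (ρ : H →ₐ[𝕜] Module.End 𝕜 V) (h : H) (x : 𝕜 ⊗[𝕜] V) :
    TensorProduct.lid 𝕜 V (tensorRep (charRep χ.ofConv) ρ h x) =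
      ρ (winding χ h) (TensorProduct.lid 𝕜 V x) := by
  rw [winding_apply]
  change TensorProduct.lid 𝕜 V (Module.endTensorEndAlgHom (R := 𝕜) (S := 𝕜) (A := 𝕜)
    (Algebra.TensorProduct.map (charRep χ.ofConv) ρ (Coalgebra.comul (R := 𝕜) h)) x) = _
  generalize Coalgebra.comul (R := 𝕜) h = t
  induction t with
  | zero => simp
  | add s t hs ht => simp only [map_add, LinearMap.add_apply, hs, ht]
  | tmul a b =>
    induction x with
    | zero => simp
    | add s t hs ht => simp only [map_add, hs, ht]
    | tmul r y =>
      simp [Module.endTensorEndAlgHom_apply, charRep, mul_smul, smul_comm r]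

namespace CentralHopfSubalgebra

open WithConv Coalgebra

variable {𝕜 : Type v} {H : Type u} [Field 𝕜] [Ring H] [HopfAlgebra 𝕜 H]

theorem charEquiv_mem_stab_iff (C : CentralHopfSubalgebra 𝕜 H) {m : Ideal C.toSubalgebra}
    (V : IrrModule 𝕜 (C.Fiber m)) (χ : C.charSubgroup) :
    C.charEquiv χ ∈ C.stab V ↔ C.charTwist χ V ≈ V := by
  rw [charTwist_equiv_iff]
  have key := lid_tensorRep_charRep χ.1 (C.fiberRep V)
  constructor
  · rintro ⟨e, he⟩
    refine ⟨(TensorProduct.lid 𝕜 V.carrier).symm.trans e, fun h x => ?_⟩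
    rw [LinearEquiv.trans_apply, LinearEquiv.trans_apply, ← he, toChar_charEquiv]
    congr 1
    rw [LinearEquiv.symm_apply_eq, key, LinearEquiv.apply_symm_apply]
  · rintro ⟨e, he⟩
    refine ⟨(TensorProduct.lid 𝕜 V.carrier).trans e, fun h x => ?_⟩
    rw [LinearEquiv.trans_apply, LinearEquiv.trans_apply, ← he, toChar_charEquiv, key]

/-- The stabilizer in the sense of tensor products is the stabilizer of the isomorphism class. -/
theorem card_stab (C : CentralHopfSubalgebra 𝕜 H) {m : Ideal C.toSubalgebra}
    (V : IrrModule 𝕜 (C.Fiber m)) : Nat.card (C.stab V) =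
      Nat.card (MulAction.stabilizer C.charSubgroup (Irr.mk V)) := by
  refine (Nat.card_congr (C.charEquiv.subtypeEquiv fun χ => ?_)).symm
  rw [charEquiv_mem_stab_iff]
  exact Irr.mk_eq_mk

end CentralHopfSubalgebra

/-! ### Transitivity and the bound on stabilizers -/

namespace CentralHopfSubalgebra

open WithConv Coalgebra

variable {𝕜 : Type v} {H : Type u} [Field 𝕜] [Ring H] [HopfAlgebra 𝕜 H]

/-- If `C` acts by scalars, then it acts through the counit in the adjoint action, so the latter
factors through the identity fiber. -/
theorem exists_adjointAction_lift (C : CentralHopfSubalgebra 𝕜 H) {E : Type*} [Ring E] [Algebra 𝕜 E]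
    (ρ : H →ₐ[𝕜] E) (hρ : ∀ c : C.toSubalgebra, ∃ r : 𝕜, ρ c = algebraMap 𝕜 E r) :
    ∃ φ : C.IdentityFiber →ₐ[𝕜] Module.End 𝕜 E,
      ∀ h, φ (Ideal.Quotient.mk _ h) = adjointAction ρ h := by
  refine ⟨Ideal.Quotient.liftₐ _ (adjointAction ρ)
    (C.eq_zero_of_mem_fiberIdeal _ _ fun c hc => ?_), fun h => rfl⟩
  have hc' : counit (R := 𝕜) (c : H) = 0 := hc
  ext F
  rw [adjointAction_apply, C.map_comul_congr (f := LinearMap.mulRight 𝕜 F ∘ₗ ρ.toLinearMap)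
    (f' := LinearMap.mulLeft 𝕜 F ∘ₗ ρ.toLinearMap) (fun c => ?_) (fun c => rfl)]
  · have key : ∀ t : H ⊗[𝕜] H, LinearMap.mul' 𝕜 E
        (TensorProduct.map (LinearMap.mulLeft 𝕜 F ∘ₗ ρ.toLinearMap)
          (ρ.toLinearMap ∘ₗ HopfAlgebra.antipode 𝕜) t) =
        F * ρ (LinearMap.mul' 𝕜 H ((HopfAlgebra.antipode 𝕜).lTensor H t)) := by
      intro t
      induction t with
      | zero => simp
      | add s t hs ht => simp only [map_add, mul_add, hs, ht]
      | tmul a b => simp [mul_assoc]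
    rw [key, HopfAlgebra.mul_antipode_lTensor_comul_apply, hc']
    simp
  · obtain ⟨r, hr⟩ := hρ c
    simp [hr, Algebra.commutes]

/-- Eigencharacters of the adjoint action, seen as elements of the group of characters. -/
theorem mul_eq_mul_winding_iff (C : CentralHopfSubalgebra 𝕜 H) {E : Type*} [Ring E] [Algebra 𝕜 E]
    (ρ : H →ₐ[𝕜] E) (φ : C.IdentityFiber →ₐ[𝕜] Module.End 𝕜 E)
    (hφ : ∀ h, φ (Ideal.Quotient.mk _ h) = adjointAction ρ h) (χ : C.charSubgroup) (F : E) :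
    (∀ h, ρ h * F = F * ρ (winding χ.1 h)) ↔ ∀ a, φ a F = C.charEquiv χ a • F := by
  rw [← adjointAction_eq_smul_iff]
  constructor
  · intro H' a
    obtain ⟨h, rfl⟩ := Ideal.Quotient.mk_surjective a
    rw [hφ]
    exact H' h
  · intro H' h
    rw [← hφ]
    exact H' (Ideal.Quotient.mk _ h)

/-- If the identity fiber is basic, then every nonzero corner `e E e'` of a finite dimensional
algebra `E`, for `e` and `e'` centralizing the image of `ρ`, contains an element intertwining `ρ`
with one of its twists. -/
theorem exists_mul_eq_mul_winding (C : CentralHopfSubalgebra 𝕜 H)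
    (hbasic : IsBasicAlgebra 𝕜 C.IdentityFiber) {E : Type*} [Ring E] [Algebra 𝕜 E]
    [FiniteDimensional 𝕜 E] (ρ : H →ₐ[𝕜] E)
    (hρ : ∀ c : C.toSubalgebra, ∃ r : 𝕜, ρ c = algebraMap 𝕜 E r) {e e' : E}
    (he : ∀ h, Commute e (ρ h)) (he' : ∀ h, Commute e' (ρ h))
    (hne : ∃ F, F ≠ 0 ∧ e * F * e' = F) :
    ∃ χ : C.charSubgroup, ∃ F, F ≠ 0 ∧ e * F * e' = F ∧
      ∀ h, ρ h * F = F * ρ (winding χ.1 h) := by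
  obtain ⟨φ, hφ⟩ := C.exists_adjointAction_lift ρ hρ
  let P : Submodule 𝕜 E := LinearMap.eqLocus
    (LinearMap.mulLeft 𝕜 e ∘ₗ LinearMap.mulRight 𝕜 e') LinearMap.id
  have hP (F : E) : F ∈ P ↔ e * F * e' = F := by
    rw [mul_assoc]; rfl
  have hPne : P ≠ ⊥ := by
    obtain ⟨F, hF0, hF⟩ := hne
    exact P.ne_bot_iff.2 ⟨F, (hP F).2 hF, hF0⟩
  have hstab (a : C.IdentityFiber) (F : E) (hF : F ∈ P) : φ a F ∈ P := by
    obtain ⟨h, rfl⟩ := Ideal.Quotient.mk_surjective a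
    rw [hP] at hF ⊢
    rw [hφ, mul_adjointAction_mul ρ he he', hF]
  obtain ⟨χ', F, hFP, hF0, hF⟩ := hbasic.exists_common_eigenvector φ P hPne hstab
  obtain ⟨χ, rfl⟩ := C.charEquiv.surjective χ'
  exact ⟨χ, F, hF0, (hP F).1 hFP, (C.mul_eq_mul_winding_iff ρ φ hφ χ F).2 hF⟩

variable [IsAlgClosed 𝕜] [Algebra.FiniteType 𝕜 H]

theorem exists_fiberRep_coe (C : CentralHopfSubalgebra 𝕜 H) [Module.Finite C.toSubalgebra H]
    (m : MaximalSpectrum C.toSubalgebra) (c : C.toSubalgebra) :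
    ∃ r : 𝕜, ∀ V : IrrModule 𝕜 (C.Fiber m.asIdeal), C.fiberRep V c = algebraMap 𝕜 _ r := by
  obtain ⟨r, hr⟩ := C.exists_mk_coe_eq_algebraMap m c
  refine ⟨r, fun V => ?_⟩
  change V.rep (Ideal.Quotient.mk _ (c : H)) = _
  rw [hr, AlgHom.commutes]

/-- Any two irreducible modules over the same fiber are related by a character: an eigenvector of
the adjoint action on `Hom(W, V) ⊆ End(V × W)` intertwines a twist of `W` with `V`. -/
theorem exists_charTwist_equiv (C : CentralHopfSubalgebra 𝕜 H) [Module.Finite C.toSubalgebra H]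
    (hbasic : IsBasicAlgebra 𝕜 C.IdentityFiber) (m : MaximalSpectrum C.toSubalgebra)
    (V W : IrrModule 𝕜 (C.Fiber m.asIdeal)) : ∃ χ : C.charSubgroup, C.charTwist χ W ≈ V := by
  have := C.finiteDimensional_fiber m
  have := V.finiteDimensional
  have := W.finiteDimensional
  let ρ : H →ₐ[𝕜] Module.End 𝕜 (V.carrier × W.carrier) :=
    (LinearMap.prodMapAlgHom 𝕜 V.carrier W.carrier).comp ((C.fiberRep V).prod (C.fiberRep W))
  have hρ_apply (h : H) (x : V.carrier × W.carrier) :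
      ρ h x = (C.fiberRep V h x.1, C.fiberRep W h x.2) := rfl
  have hρ (c : C.toSubalgebra) : ∃ r : 𝕜, ρ c = algebraMap 𝕜 _ r := by
    obtain ⟨r, hr⟩ := C.exists_fiberRep_coe m c
    refine ⟨r, LinearMap.ext fun x => ?_⟩
    rw [hρ_apply, hr, hr]
    rfl
  -- The projections onto the two summands; they cut out `Hom(W, V)` from `End(V × W)`.
  let e : Module.End 𝕜 (V.carrier × W.carrier) := LinearMap.prodMap LinearMap.id 0
  let e' : Module.End 𝕜 (V.carrier × W.carrier) := LinearMap.prodMap 0 LinearMap.id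
  have he (h : H) : Commute e (ρ h) := LinearMap.ext fun x => by
    simp [e, Module.End.mul_apply, hρ_apply]
  have he' (h : H) : Commute e' (ρ h) := LinearMap.ext fun x => by
    simp [e', Module.End.mul_apply, hρ_apply]
  have hne : ∃ F, F ≠ 0 ∧ e * F * e' = F := by
    have := IsSimpleModule.nontrivial (C.Fiber m.asIdeal) V.carrier
    have := IsSimpleModule.nontrivial (C.Fiber m.asIdeal) W.carrier
    obtain ⟨f, hf⟩ := exists_ne (0 : W.carrier →ₗ[𝕜] V.carrier)
    refine ⟨LinearMap.inl 𝕜 _ _ ∘ₗ f ∘ₗ LinearMap.snd 𝕜 _ _, fun h0 => hf ?_, ?_⟩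
    · refine LinearMap.ext fun y => ?_
      exact congrArg Prod.fst (DFunLike.congr_fun h0 ((0 : V.carrier), y))
    · refine LinearMap.ext fun x => ?_
      simp [e, e', Module.End.mul_apply]
  obtain ⟨χ, F, hF0, hFe, hint⟩ := C.exists_mul_eq_mul_winding hbasic ρ hρ he he' hne
  refine ⟨χ, IrrModule.equiv_of_intertwining _ _
    (LinearMap.fst 𝕜 _ _ ∘ₗ F ∘ₗ LinearMap.inr 𝕜 V.carrier W.carrier) (fun h0 => hF0 ?_) ?_⟩
  · rw [← hFe]
    refine LinearMap.ext fun x => ?_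
    have : (F (0, x.2)).1 = 0 := DFunLike.congr_fun h0 x.2
    simp [e, e', Module.End.mul_apply, this]
  · intro a x
    obtain ⟨h, rfl⟩ := Ideal.Quotient.mk_surjective a
    have hx (y : W.carrier) : C.fiberRep V h (F (0, y)).1 =
        (F (0, C.fiberRep W (winding χ.1 h) y)).1 := by
      have := congrArg Prod.fst (DFunLike.congr_fun (hint h) ((0 : V.carrier), y))
      simpa [Module.End.mul_apply, hρ_apply] using this
    exact (hx x).symm

theorem finiteDimensional_identityFiber (C : CentralHopfSubalgebra 𝕜 H)
    [Module.Finite C.toSubalgebra H] : FiniteDimensional 𝕜 C.IdentityFiber :=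
  C.finiteDimensional_fiber C.augmentation

theorem finite_G₀ (C : CentralHopfSubalgebra 𝕜 H) [Module.Finite C.toSubalgebra H] :
    Finite C.G₀ :=
  have := C.finiteDimensional_identityFiber
  finite_algHom_of_finiteDimensional C.IdentityFiber

/-- Isomorphisms `χ ⊗ V ≅ V` for distinct `χ` are linearly independent in `End(V)`, being
eigenvectors of the adjoint action with distinct eigencharacters. -/
theorem card_stab_le (C : CentralHopfSubalgebra 𝕜 H) [Module.Finite C.toSubalgebra H]
    (m : MaximalSpectrum C.toSubalgebra) (V : IrrModule 𝕜 (C.Fiber m.asIdeal)) :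
    Nat.card (C.stab V) ≤ V.dim ^ 2 := by
  have := C.finiteDimensional_fiber m
  have := V.finiteDimensional
  have := C.finite_G₀
  obtain ⟨φ, hφ⟩ := C.exists_adjointAction_lift (C.fiberRep V) fun c => by
    obtain ⟨r, hr⟩ := C.exists_fiberRep_coe m c
    exact ⟨r, hr V⟩
  have key (χ : C.stab V) : ∃ F : Module.End 𝕜 V.carrier, F ≠ 0 ∧ ∀ a, φ a F = χ.1 a • F := by
    obtain ⟨χ, hχ⟩ := χ
    obtain ⟨χ, rfl⟩ := C.charEquiv.surjective χ
    obtain ⟨e, he⟩ := (C.charTwist_equiv_iff _ _ _).1 ((C.charEquiv_mem_stab_iff V χ).1 hχ)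
    refine ⟨e.toLinearMap, fun h0 => ?_, (C.mul_eq_mul_winding_iff _ φ hφ χ _).1 fun h =>
      LinearMap.ext fun x => (he h x).symm⟩
    obtain ⟨x, hx⟩ := @exists_ne _ (IsSimpleModule.nontrivial (C.Fiber m.asIdeal) V.carrier) 0
    exact hx (e.injective ((DFunLike.congr_fun h0 x).trans (map_zero e).symm))
  choose F hF0 hF using key
  have hind := linearIndependent_of_eigencharacters φ (fun χ : C.stab V => χ.1)
    Subtype.val_injective F hF0 hF
  have := Fintype.ofFinite (C.stab V)
  have hle := hind.fintype_card_le_finrank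
  rwa [Module.finrank_linearMap, ← Nat.card_eq_fintype_card, ← sq] at hle

end CentralHopfSubalgebra

/-! ### The square dimension function -/

namespace CentralHopfSubalgebra

variable {𝕜 : Type v} {H : Type u} [Field 𝕜] [Ring H] [HopfAlgebra 𝕜 H] [IsAlgClosed 𝕜]
  [Algebra.FiniteType 𝕜 H]

theorem isPretransitive_irr (C : CentralHopfSubalgebra 𝕜 H) [Module.Finite C.toSubalgebra H]
    (hbasic : IsBasicAlgebra 𝕜 C.IdentityFiber) (m : MaximalSpectrum C.toSubalgebra) :
    MulAction.IsPretransitive C.charSubgroup (Irr 𝕜 (C.Fiber m.asIdeal)) where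
  exists_smul_eq := by
    rintro ⟨W⟩ ⟨V⟩
    obtain ⟨χ, hχ⟩ := C.exists_charTwist_equiv hbasic m V W
    exact ⟨χ, Irr.mk_eq_mk.2 hχ⟩

theorem finite_irr (C : CentralHopfSubalgebra 𝕜 H) [Module.Finite C.toSubalgebra H]
    (hbasic : IsBasicAlgebra 𝕜 C.IdentityFiber) (m : MaximalSpectrum C.toSubalgebra) :
    Finite (Irr 𝕜 (C.Fiber m.asIdeal)) := by
  obtain ⟨V⟩ := C.nonempty_irrModule m
  have := C.isPretransitive_irr hbasic m
  have := C.finite_G₀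
  have := Finite.of_equiv _ C.charEquiv.symm
  exact Finite.of_surjective _ (MulAction.surjective_smul C.charSubgroup (Irr.mk V))

/-- Orbit counting: all irreducible modules over a fiber have the same dimension, and their number
is the index of a stabilizer. -/
theorem sqDim_mul_card_stab (C : CentralHopfSubalgebra 𝕜 H) [Module.Finite C.toSubalgebra H]
    (hbasic : IsBasicAlgebra 𝕜 C.IdentityFiber) (m : MaximalSpectrum C.toSubalgebra)
    (V : IrrModule 𝕜 (C.Fiber m.asIdeal)) :
    C.sqDim m * Nat.card (C.stab V) = Nat.card C.G₀ * V.dim ^ 2 := by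
  have := C.isPretransitive_irr hbasic m
  have := C.finite_irr hbasic m
  have hdim (X : Irr 𝕜 (C.Fiber m.asIdeal)) : X.dim = V.dim := by
    obtain ⟨χ, rfl⟩ := MulAction.exists_smul_eq C.charSubgroup (Irr.mk V) X
    rfl
  have hsum : C.sqDim m = Nat.card (Irr 𝕜 (C.Fiber m.asIdeal)) * V.dim ^ 2 := by
    have := Fintype.ofFinite (Irr 𝕜 (C.Fiber m.asIdeal))
    unfold sqDim
    rw [finsum_eq_sum_of_fintype]
    simp [hdim]
  have hcard : Nat.card (Irr 𝕜 (C.Fiber m.asIdeal)) * Nat.card (C.stab V) = Nat.card C.G₀ := by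
    rw [card_stab, ← Nat.card_congr C.charEquiv,
      ← (MulAction.stabilizer C.charSubgroup (Irr.mk V)).index_mul_card,
      MulAction.index_stabilizer_of_transitive]
  rw [hsum, ← hcard]
  ring

theorem card_stab_pos (C : CentralHopfSubalgebra 𝕜 H) [Module.Finite C.toSubalgebra H]
    (m : MaximalSpectrum C.toSubalgebra) (V : IrrModule 𝕜 (C.Fiber m.asIdeal)) :
    0 < Nat.card (C.stab V) := by
  have := C.finite_G₀
  have := Finite.of_equiv _ C.charEquiv.symm
  rw [card_stab]
  exact Nat.card_pos

theorem card_G₀_pos (C : CentralHopfSubalgebra 𝕜 H) [Module.Finite C.toSubalgebra H] :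
    0 < Nat.card C.G₀ := by
  have := C.finite_G₀
  have := Finite.of_equiv _ C.charEquiv.symm
  rw [← Nat.card_congr C.charEquiv]
  exact Nat.card_pos

theorem card_G₀_le_sqDim (C : CentralHopfSubalgebra 𝕜 H) [Module.Finite C.toSubalgebra H]
    (hbasic : IsBasicAlgebra 𝕜 C.IdentityFiber) (m : MaximalSpectrum C.toSubalgebra) :
    Nat.card C.G₀ ≤ C.sqDim m := by
  obtain ⟨V⟩ := C.nonempty_irrModule m
  refine Nat.le_of_mul_le_mul_right ?_ (C.card_stab_pos m V)
  rw [C.sqDim_mul_card_stab hbasic m V]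
  exact Nat.mul_le_mul_left _ (C.card_stab_le m V)

theorem sqDim_eq_iff (C : CentralHopfSubalgebra 𝕜 H) [Module.Finite C.toSubalgebra H]
    (hbasic : IsBasicAlgebra 𝕜 C.IdentityFiber) (m : MaximalSpectrum C.toSubalgebra)
    (V : IrrModule 𝕜 (C.Fiber m.asIdeal)) :
    C.sqDim m = Nat.card C.G₀ ↔ C.IsMaximallyStable V := by
  have h := C.sqDim_mul_card_stab hbasic m V
  constructor
  · intro h'
    rw [h'] at h
    exact Nat.eq_of_mul_eq_mul_left C.card_G₀_pos h
  · intro h'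
    rw [← h'] at h
    exact Nat.eq_of_mul_eq_mul_right (C.card_stab_pos m V) h

/-- The minimum is attained at the identity fiber, whose irreducible modules are
one-dimensional. -/
theorem sqDim_augmentation (C : CentralHopfSubalgebra 𝕜 H) [Module.Finite C.toSubalgebra H]
    (hbasic : IsBasicAlgebra 𝕜 C.IdentityFiber) :
    C.sqDim C.augmentation = Nat.card C.G₀ := by
  have := C.finiteDimensional_identityFiber
  obtain ⟨V⟩ := C.nonempty_irrModule C.augmentation
  rw [C.sqDim_eq_iff hbasic C.augmentation V]
  have hd := V.dim_eq_one_of_isBasicAlgebra hbasic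
  have h1 := C.card_stab_le C.augmentation V
  have h2 := C.card_stab_pos C.augmentation V
  unfold IsMaximallyStable
  rw [hd] at h1 ⊢
  omega

end CentralHopfSubalgebra

theorem mainTheorem4 {𝕜 : Type v} {H : Type u} [Field 𝕜] [IsAlgClosed 𝕜] [Ring H]
    [HopfAlgebra 𝕜 H] [Algebra.FiniteType 𝕜 H] (C : CentralHopfSubalgebra 𝕜 H)
    [Module.Finite C.toSubalgebra H] (hbasic : IsBasicAlgebra 𝕜 C.IdentityFiber) :
    -- the cardinalities, dimensions and sums below are finite
    Finite C.G₀ ∧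
    (∀ m : MaximalSpectrum C.toSubalgebra,
      Finite (Irr 𝕜 (C.Fiber m.asIdeal)) ∧ Nonempty (Irr 𝕜 (C.Fiber m.asIdeal)) ∧
      ∀ V : IrrModule 𝕜 (C.Fiber m.asIdeal), FiniteDimensional 𝕜 V.carrier) ∧
    -- (a)
    (∀ (m : MaximalSpectrum C.toSubalgebra) (V : IrrModule 𝕜 (C.Fiber m.asIdeal)),
      (C.sqDim m : ℚ) = (Nat.card C.G₀ : ℚ) * (V.dim : ℚ) ^ 2 / (Nat.card (C.stab V) : ℚ)) ∧
    -- (b)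
    IsLeast (Set.range C.sqDim) (Nat.card C.G₀) ∧
    -- (c)
    (∀ m : MaximalSpectrum C.toSubalgebra, List.TFAE [
      C.sqDim m = Nat.card C.G₀,
      ∃ V : IrrModule 𝕜 (C.Fiber m.asIdeal), C.IsMaximallyStable V,
      ∀ V : IrrModule 𝕜 (C.Fiber m.asIdeal), C.IsMaximallyStable V]) := by
  refine ⟨C.finite_G₀, fun m => ⟨C.finite_irr hbasic m, (C.nonempty_irrModule m).map Irr.mk,
    fun V => ?_⟩, fun m V => ?_, ⟨⟨_, C.sqDim_augmentation hbasic⟩, ?_⟩, fun m => ?_⟩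
  · have := C.finiteDimensional_fiber m
    exact V.finiteDimensional
  · have hpos := C.card_stab_pos m V
    rw [eq_div_iff (by positivity)]
    exact_mod_cast C.sqDim_mul_card_stab hbasic m V
  · rintro _ ⟨m, rfl⟩
    exact C.card_G₀_le_sqDim hbasic m
  · tfae_have 1 → 3 := fun h V => (C.sqDim_eq_iff hbasic m V).1 h
    tfae_have 3 → 2 := fun h => (C.nonempty_irrModule m).elim fun V => ⟨V, h V⟩
    tfae_have 2 → 1 := fun ⟨V, hV⟩ => (C.sqDim_eq_iff hbasic m V).2 hV
    tfae_finish
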